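/- Let $M,N\ge 2$, let $Y$ be a random real $M\times N$ matrix, and let $0<C_1<C_2<\infty$. Assume that the rows of $Y$ are i.i.d. random vectors in $[0,1]^N$, or that the columns of $Y$ are i.i.d. random vectors in $[0,1]^M$, whose common law has a density $f$ with respect to Lebesgue measure on the cube with $C_1<f<C_2$. Write $\|A\|_{F,1}=\sum_{i,j}|A_{ij}|$ and $\|A\|_{F,2}^2=\sum_{i,j}|A_{ij}|^2$. For $p\ge 1$, parameters $\alpha\ge 0$, $\nu,\gamma>0$, and entrywise non-negative $U\in\mathbb R^{M\times p}$, $\Sigma\in\mathbb R^{p\times p}$, $V\in\mathbb R^{p\times N}$ put $$J_p(U,\Sigma,V)=\|Y-U\Sigma V\|_{F,2}^2+\gamma\|\Sigma\|_{F,1}+\nu\|U\|_{F,1}+\nu\|V\|_{F,1}+\alpha\|U^TU-I\|_{F,1}+\alpha\|VV^T-I\|_{F,1}.$$ Let $(\tilde U_p,\tilde\Sigma_p,\tilde V_p)$ denote a minimizer of $J_p$ over the non-negative triples. List the $p^2$ entries of $\tilde\Sigma_p$ in decreasing order (ties in any order) and, for $0\le\tilde p\le p^2$, let $\tilde\Sigma_{p,\tilde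 p}$ be the matrix that keeps the first $\tilde p$ of them, at their positions, and has zeros elsewhere. Put $\mu(N,M,l)=\frac{l(l-1)}2+MN-|N-M|-1$ for real $l$. There are constants $C_3>0$ and $\delta_0>0$, depending only on $C_1$ and $C_2$, such that the following holds for all $M,N\ge2$, all $Y$ as above, all $K>1$, $C>0$, $L>0$, all $0<\delta<\delta_0$, and all $\alpha\ge0$, $\nu,\gamma>0$. Let $$\varepsilon=\delta\bigl((K+CL)NM+\min(M,N)^2\bigr)^{-1},\qquad p_{N,M,\delta}=\sqrt{\frac{\max(M,N)}{|\log(C_3\varepsilon)|}},$$ and suppose that $\gamma+2\nu\le(K-1)\varepsilon$. Then minimizers of $J_p$ exist for every $p\ge1$, $C_3\varepsilon<1$, and for every choice of integers $\tilde p=\tilde p(p)$ with $e^{-L\varepsilon}p^2<\tilde p\le p^2$ $(1\le p\le\min(M,N))$, $$\mathbb P\Bigl(\min_{1\le p\le\min(M,N)}J_p(\tilde U_p,\tilde\Sigma_{p,\tilde p},\tilde V_p)<\delta\Bigr)\ \ge\ \min(N,M)\;p_{N,M,\delta}^{\max(N,M)}\,(C_3\varepsilon)^{\mu(N,M,p_{N,M,\delta})},$$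 in the sense that some measurable event of at least this probability is contained in the event that the inequality $\min_{p}J_p(\tilde U_p,\tilde\Sigma_{p,\tilde p},\tilde V_p)<\delta$ holds for every choice of the minimizers and of the orders of ties. -/

import Mathlib

open MeasureTheory ProbabilityTheory

namespace TriNMF

/-- The entrywise `l¹` norm `‖A‖_{F,1} = ∑ |A i j|`. -/
def l1Norm {m n : ℕ} (A : Matrix (Fin m) (Fin n) ℝ) : ℝ := ∑ i, ∑ j, |A i j|

/-- The squared Frobenius norm `‖A‖_{F,2}² = ∑ |A i j|²`. -/
def frobSq {m n : ℕ} (A : Matrix (Fin m) (Fin n) ℝ) : ℝ := ∑ i, ∑ j, |A i j| ^ 2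

/-- A triple `(U, Σ, V)` of factors of inner dimension `p` for an `M × N` matrix. -/
@[ext]
structure Triple (M N p : ℕ) where
  U : Matrix (Fin M) (Fin p) ℝ
  S : Matrix (Fin p) (Fin p) ℝ
  V : Matrix (Fin p) (Fin N) ℝ

/-- All three factors are entrywise non-negative. -/
def Triple.Nonneg {M N p : ℕ} (T : Triple M N p) : Prop :=
  (∀ i j, 0 ≤ T.U i j) ∧ (∀ i j, 0 ≤ T.S i j) ∧ (∀ i j, 0 ≤ T.V i j)

/-- The regularised tri-factorization functional. The columns of `U` and the rows of `V` are the
basis vectors, so the orthogonality penalties are taken on the two `p × p` Gram matrices. -/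
def J {M N p : ℕ} (α ν γ : ℝ) (Y : Matrix (Fin M) (Fin N) ℝ) (T : Triple M N p) : ℝ :=
  frobSq (Y - T.U * T.S * T.V) + γ * l1Norm T.S + ν * l1Norm T.U + ν * l1Norm T.V
    + α * l1Norm (T.U.transpose * T.U - 1) + α * l1Norm (T.V * T.V.transpose - 1)

/-- `T` minimises the functional among all non-negative triples of inner dimension `p`. -/
def IsMinimizer {M N p : ℕ} (α ν γ : ℝ) (Y : Matrix (Fin M) (Fin N) ℝ) (T : Triple M N p) :
    Prop :=
  T.Nonneg ∧ ∀ T' : Triple M N p, T'.Nonneg → J α ν γ Y T ≤ J α ν γ Y T'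

/-- `e` lists the `p²` positions of the matrix `S` in an order of decreasing entries. -/
def IsDecreasingOrder {p : ℕ} (S : Matrix (Fin p) (Fin p) ℝ)
    (e : Fin (p ^ 2) ≃ Fin p × Fin p) : Prop :=
  Antitone fun l => S (e l).1 (e l).2

/-- The matrix that keeps the first `q` entries of `S` in the order `e`, all others being `0`. -/
def truncate {p : ℕ} (S : Matrix (Fin p) (Fin p) ℝ) (e : Fin (p ^ 2) ≃ Fin p × Fin p) (q : ℕ) :
    Matrix (Fin p) (Fin p) ℝ :=
  ∑ l ∈ Finset.univ.filter (fun l : Fin (p ^ 2) => l.val < q),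
    Matrix.single (e l).1 (e l).2 (S (e l).1 (e l).2)

/-- The event-defining condition on the data matrix `Y`: whatever minimisers `T p` and whatever
decreasing orders `e p` of the entries of their middle factors are chosen, the minimum over
`1 ≤ p ≤ min M N` of the functional at the triples truncated to `q p` entries is less than `δ`. -/
def TruncatedMinLT {M N : ℕ} (α ν γ δ : ℝ) (q : ℕ → ℕ) (Y : Matrix (Fin M) (Fin N) ℝ) : Prop :=
  ∀ (T : ∀ p, Triple M N p) (e : ∀ p, Fin (p ^ 2) ≃ Fin p × Fin p),
    (∀ p ∈ Set.Icc 1 (min M N),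
      IsMinimizer α ν γ Y (T p) ∧ IsDecreasingOrder (T p).S (e p)) →
    ∃ m, IsLeast ((fun p => J α ν γ Y ⟨(T p).U, truncate (T p).S (e p) (q p), (T p).V⟩) ''
      Set.Icc 1 (min M N)) m ∧ m < δ

/-- The vectors `X 0, …, X (n - 1)` are i.i.d. in `[0,1]^d`, with a density with respect to
Lebesgue measure on the cube that lies strictly between `C₁` and `C₂`. -/
def IsIIDWithDensityBounds {Ω : Type*} [MeasurableSpace Ω] (P : Measure Ω) {n d : ℕ}
    (X : Fin n → Ω → (Fin d → ℝ)) (C₁ C₂ : ℝ) : Prop :=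
  (∀ i, Measurable (X i)) ∧ iIndepFun X P ∧
    ∃ f : (Fin d → ℝ) → ℝ, Measurable f ∧ (∀ x ∈ Set.Icc 0 1, C₁ < f x ∧ f x < C₂) ∧
      ∀ i, P.map (X i) =
        (volume.restrict (Set.Icc (0 : Fin d → ℝ) 1)).withDensity fun x => ENNReal.ofReal (f x)

/-- The exponent `μ(N, M, l) = l (l - 1) / 2 + M N - |N - M| - 1`, for real `l`. -/
noncomputable def mu (N M : ℕ) (l : ℝ) : ℝ :=
  l * (l - 1) / 2 + (M : ℝ) * N - |(N : ℝ) - M| - 1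

/-- `ε = δ ((K + C L) N M + min(M, N)²)⁻¹`. -/
noncomputable def eps (K C L : ℝ) (N M : ℕ) (δ : ℝ) : ℝ :=
  δ * ((K + C * L) * N * M + (min (M : ℝ) N) ^ 2)⁻¹

/-- `p_{N,M,δ} = √(max(M, N) / |log (C₃ ε)|)`. -/
noncomputable def pOpt (C₃ ε : ℝ) (N M : ℕ) : ℝ :=
  √(max (M : ℝ) N / |Real.log (C₃ * ε)|)

/-- `min(N, M) p^{max(N, M)} (C₃ ε)^{μ(N, M, p)}` at `p = p_{N,M,δ}`. -/
noncomputable def lowerBound (C₃ ε : ℝ) (N M : ℕ) : ℝ :=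
  min (N : ℝ) M * pOpt C₃ ε N M ^ max N M * (C₃ * ε) ^ mu N M (pOpt C₃ ε N M)

end TriNMF

namespace TriNMF

/-! Inner dimension `p = 1` alone gives the bound. There the condition on `q` forces `q 1 = 1`, so
nothing is truncated and any non-negative rank-one triple with `J < δ` suffices
(`truncatedMinLT_of_triple_one`). Let `M ≤ N`; transposition gives the other case. If all rows of
`Y` lie within `√ε` entrywise of one vector `w`, factor the matrix with all rows `w` through unit
vectors: the orthogonality penalties vanish and `J ≤ M N ε + (γ + 2ν) M N ≤ K ε M N < δ`
(`exists_triple_one_of_rows`). Summing over the grid cells that can contain `w`, such rows occur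
with probability at least about `ε ^ ((M - 1) N / 2)`, whether rows or columns are i.i.d.
(`exists_event_rows_close`). The claimed bound has the exponent `(M - 1)(N + 1) + l (l - 1) / 2`
with `l = p_{N,M,δ}`, about twice as large; this surplus absorbs the prefactor `M l ^ N`
(`target_le_event_bound`). -/

/-! ### Norms, transposition and existence of minimizers -/

theorem l1Norm_nonneg {m n : ℕ} (A : Matrix (Fin m) (Fin n) ℝ) : 0 ≤ l1Norm A :=
  Finset.sum_nonneg fun _ _ => Finset.sum_nonneg fun _ _ => abs_nonneg _

theorem frobSq_nonneg {m n : ℕ} (A : Matrix (Fin m) (Fin n) ℝ) : 0 ≤ frobSq A :=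
  Finset.sum_nonneg fun _ _ => Finset.sum_nonneg fun _ _ => by positivity

theorem l1Norm_transpose {m n : ℕ} (A : Matrix (Fin m) (Fin n) ℝ) :
    l1Norm A.transpose = l1Norm A := Finset.sum_comm

theorem frobSq_transpose {m n : ℕ} (A : Matrix (Fin m) (Fin n) ℝ) :
    frobSq A.transpose = frobSq A := Finset.sum_comm

theorem abs_apply_le_l1Norm {m n : ℕ} (A : Matrix (Fin m) (Fin n) ℝ) (i : Fin m) (j : Fin n) :
    |A i j| ≤ l1Norm A :=
  (Finset.single_le_sum (f := fun j => |A i j|) (fun _ _ => abs_nonneg _) (Finset.mem_univ j)).trans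
    (Finset.single_le_sum (f := fun i => ∑ j, |A i j|)
      (fun _ _ => Finset.sum_nonneg fun _ _ => abs_nonneg _) (Finset.mem_univ i))

@[fun_prop]
theorem continuous_l1Norm {m n : ℕ} :
    Continuous (l1Norm : Matrix (Fin m) (Fin n) ℝ → ℝ) := by
  unfold l1Norm; fun_prop

@[fun_prop]
theorem continuous_frobSq {m n : ℕ} :
    Continuous (frobSq : Matrix (Fin m) (Fin n) ℝ → ℝ) := by
  unfold frobSq; fun_prop

/-- The functional is invariant under transposition of all the matrices. -/
theorem J_transpose {M N p : ℕ} (α ν γ : ℝ) (Y : Matrix (Fin M) (Fin N) ℝ) (T : Triple M N p) :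
    J α ν γ Y.transpose ⟨T.V.transpose, T.S.transpose, T.U.transpose⟩ = J α ν γ Y T := by
  have h : Y.transpose - T.V.transpose * T.S.transpose * T.U.transpose
      = (Y - T.U * T.S * T.V).transpose := by
    simp [Matrix.transpose_mul, Matrix.mul_assoc]
  simp only [J, h, frobSq_transpose, l1Norm_transpose, Matrix.transpose_transpose]
  ring

/-- Source of coercivity: for `ν, γ > 0` it bounds non-negative triples in a sublevel set. -/
theorem regularizers_le_J {M N p : ℕ} {α : ℝ} (hα : 0 ≤ α) (ν γ : ℝ)
    (Y : Matrix (Fin M) (Fin N) ℝ) (T : Triple M N p) :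
    γ * l1Norm T.S + ν * l1Norm T.U + ν * l1Norm T.V ≤ J α ν γ Y T := by
  have h1 := frobSq_nonneg (Y - T.U * T.S * T.V)
  have h2 := mul_nonneg hα (l1Norm_nonneg (T.U.transpose * T.U - 1))
  have h3 := mul_nonneg hα (l1Norm_nonneg (T.V * T.V.transpose - 1))
  unfold J
  linarith

/-- The functional has a minimizer among the non-negative triples, because it is continuous and
coercive. -/
theorem exists_isMinimizer {M N p : ℕ} {α ν γ : ℝ} (hα : 0 ≤ α) (hν : 0 < ν) (hγ : 0 < γ)
    (Y : Matrix (Fin M) (Fin N) ℝ) : ∃ T : Triple M N p, IsMinimizer α ν γ Y T := by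
  set R : ℝ := J α ν γ Y (⟨0, 0, 0⟩ : Triple M N p) with hR
  have hR0 : 0 ≤ R := by
    have h := regularizers_le_J hα ν γ Y (⟨0, 0, 0⟩ : Triple M N p)
    simpa [l1Norm] using h
  -- Triples with `J ≤ R`, the value at zero, have entries at most `R / ν` or `R / γ`; all others
  -- lose to the zero triple.
  let box (m n : ℕ) (r : ℝ) : Set (Matrix (Fin m) (Fin n) ℝ) :=
    Set.univ.pi fun _ => Set.univ.pi fun _ => Set.Icc 0 r
  have hbox (m n : ℕ) (r : ℝ) : IsCompact (box m n r) :=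
    isCompact_univ_pi fun _ => isCompact_univ_pi fun _ => isCompact_Icc
  have hmem {m n : ℕ} {r : ℝ} {A : Matrix (Fin m) (Fin n) ℝ} :
      A ∈ box m n r ↔ ∀ i j, 0 ≤ A i j ∧ A i j ≤ r :=
    ⟨fun h i j => h i trivial j trivial, fun h i _ j _ => h i j⟩
  have hcont : Continuous fun x : Matrix (Fin M) (Fin p) ℝ × Matrix (Fin p) (Fin p) ℝ ×
      Matrix (Fin p) (Fin N) ℝ => J α ν γ Y ⟨x.1, x.2.1, x.2.2⟩ := by
    unfold J; fun_prop
  have h0 (m n : ℕ) {r : ℝ} (hr : 0 ≤ r) : (0 : Matrix (Fin m) (Fin n) ℝ) ∈ box m n r :=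
    hmem.2 fun i j => ⟨le_rfl, hr⟩
  have hν' : 0 ≤ R / ν := by positivity
  have hγ' : 0 ≤ R / γ := by positivity
  obtain ⟨⟨U, S, V⟩, ⟨hU, hS, hV⟩, hmin⟩ :=
    ((hbox M p (R / ν)).prod ((hbox p p (R / γ)).prod (hbox p N (R / ν)))).exists_isMinOn
      ⟨(0, 0, 0), h0 _ _ hν', h0 _ _ hγ', h0 _ _ hν'⟩ hcont.continuousOn
  refine ⟨⟨U, S, V⟩, ⟨fun i j => (hmem.1 hU i j).1, fun i j => (hmem.1 hS i j).1,
    fun i j => (hmem.1 hV i j).1⟩, fun T hT => ?_⟩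
  by_cases hle : J α ν γ Y T ≤ R
  · have hreg := (regularizers_le_J hα ν γ Y T).trans hle
    have hS' := mul_nonneg hγ.le (l1Norm_nonneg T.S)
    have hU' := mul_nonneg hν.le (l1Norm_nonneg T.U)
    have hV' := mul_nonneg hν.le (l1Norm_nonneg T.V)
    have key {m n : ℕ} {A : Matrix (Fin m) (Fin n) ℝ} {c : ℝ} (hc : 0 < c)
        (hA : ∀ i j, 0 ≤ A i j) (h : c * l1Norm A ≤ R) : A ∈ box m n (R / c) := by
      refine hmem.2 fun i j => ⟨hA i j, ?_⟩
      rw [le_div_iff₀' hc]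
      refine le_trans ?_ h
      gcongr
      exact (le_abs_self _).trans (abs_apply_le_l1Norm A i j)
    exact hmin (a := (T.U, T.S, T.V)) ⟨key hν hT.1 (by linarith), key hγ hT.2.1 (by linarith),
      key hν hT.2.2 (by linarith)⟩
  · exact (hmin (a := (0, 0, 0)) ⟨h0 _ _ hν', h0 _ _ hγ', h0 _ _ hν'⟩).trans (le_of_not_ge hle)

/-! ### Inner dimension one -/

theorem truncate_one (S : Matrix (Fin 1) (Fin 1) ℝ) (e : Fin (1 ^ 2) ≃ Fin 1 × Fin 1) :
    truncate S e 1 = S := by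
  ext i j
  have hi : i = 0 := Subsingleton.elim _ _
  have hj : j = 0 := Subsingleton.elim _ _
  have h1 (x : Fin (1 ^ 2)) : (e x).1 = 0 := Subsingleton.elim _ _
  have h2 (x : Fin (1 ^ 2)) : (e x).2 = 0 := Subsingleton.elim _ _
  have hf : (Finset.univ.filter fun l : Fin (1 ^ 2) => l.val < 1) = Finset.univ :=
    Finset.filter_true_of_mem fun l _ => l.isLt
  subst hi hj
  simp only [truncate, h1, h2, hf, Finset.sum_const, Finset.card_univ, Fintype.card_fin]
  simp

/-- A non-negative triple of inner dimension one on which the functional is small forces the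
truncated minimum to be small, since nothing is truncated in inner dimension one. -/
theorem truncatedMinLT_of_triple_one {M N : ℕ} (hM : 1 ≤ M) (hN : 1 ≤ N) {α ν γ δ : ℝ}
    {q : ℕ → ℕ} (hq : q 1 = 1) {Y : Matrix (Fin M) (Fin N) ℝ} {T₁ : Triple M N 1}
    (hT₁ : T₁.Nonneg) (hJ : J α ν γ Y T₁ < δ) : TruncatedMinLT α ν γ δ q Y := by
  intro T e h
  have h1 : 1 ∈ Set.Icc 1 (min M N) := ⟨le_rfl, le_min hM hN⟩
  set F : ℕ → ℝ := fun p => J α ν γ Y ⟨(T p).U, truncate (T p).S (e p) (q p), (T p).V⟩ with hF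
  obtain ⟨m, hm⟩ := ((Set.finite_Icc 1 (min M N)).image F).exists_minimal ⟨F 1, 1, h1, rfl⟩
  have hleast : IsLeast (F '' Set.Icc 1 (min M N)) m :=
    ⟨hm.1, fun y hy => (le_total m y).elim id fun hym => hm.2 hy hym⟩
  refine ⟨m, hleast, (hleast.2 ⟨1, h1, rfl⟩).trans_lt ?_⟩
  have : F 1 = J α ν γ Y (T 1) := by simp only [hF, hq, truncate_one]
  rw [this]
  exact ((h 1 h1).1.2 T₁ hT₁).trans_lt hJ

/-- If all rows of a matrix are close to one non-negative vector, then the matrix is close to a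
product of non-negative factors of inner dimension one whose outer factors are normalized. -/
theorem exists_triple_one_of_rows {M N : ℕ} (hM : 1 ≤ M) (hN : 1 ≤ N) {α ν γ η : ℝ}
    (hν : 0 ≤ ν) (hγ : 0 ≤ γ) {Y : Matrix (Fin M) (Fin N) ℝ} {w : Fin N → ℝ}
    (hw : ∀ j, 0 ≤ w j ∧ w j ≤ 1) (hY : ∀ i j, |Y i j - w j| ≤ η) :
    ∃ T : Triple M N 1, T.Nonneg ∧
      J α ν γ Y T ≤ M * N * η ^ 2 + (γ + 2 * ν) * (M * N) := by
  have hM' : (1 : ℝ) ≤ M := by exact_mod_cast hM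
  have hN' : (1 : ℝ) ≤ N := by exact_mod_cast hN
  -- a non-negative unit vector `v` with `r v = w`
  obtain ⟨v, r, hv0, hvs, hr0, hrN, hrv⟩ : ∃ (v : Fin N → ℝ) (r : ℝ), (∀ j, 0 ≤ v j) ∧
      ∑ j, v j * v j = 1 ∧ 0 ≤ r ∧ r ≤ N ∧ ∀ j, r * v j = w j := by
    have hs : 0 ≤ ∑ j, w j * w j := Finset.sum_nonneg fun j _ => mul_self_nonneg _
    have hsN : ∑ j, w j * w j ≤ N := by
      calc ∑ j, w j * w j ≤ ∑ _j : Fin N, (1 : ℝ) :=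
            Finset.sum_le_sum fun j _ => mul_le_one₀ (hw j).2 (hw j).1 (hw j).2
        _ = N := by simp
    by_cases h0 : ∑ j, w j * w j = 0
    · refine ⟨fun j => if j = ⟨0, hN⟩ then 1 else 0, 0, fun j => by positivity, by simp, le_rfl,
        by positivity, fun j => ?_⟩
      have := (Finset.sum_eq_zero_iff_of_nonneg fun j _ => mul_self_nonneg (w j)).1 h0 j
        (Finset.mem_univ j)
      simpa using (mul_self_eq_zero.1 this).symm
    · have hpos : 0 < √(∑ j, w j * w j) := Real.sqrt_pos.2 (lt_of_le_of_ne hs (Ne.symm h0))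
      refine ⟨fun j => w j / √(∑ j, w j * w j), √(∑ j, w j * w j),
        fun j => div_nonneg (hw j).1 hpos.le, ?_, hpos.le, ?_, fun j => mul_div_cancel₀ _ hpos.ne'⟩
      · simp only [div_mul_div_comm, Real.mul_self_sqrt hs, ← Finset.sum_div, div_self h0]
      · rw [Real.sqrt_le_left (by positivity)]
        nlinarith
  have hv1 (j) : v j ≤ 1 := by
    have := Finset.single_le_sum (f := fun j => v j * v j) (fun j _ => mul_self_nonneg _)
      (Finset.mem_univ j)
    simp only [hvs] at this
    nlinarith
  have hsM : 1 ≤ √(M : ℝ) := Real.one_le_sqrt.2 hM'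
  have hsM2 : √(M : ℝ) * √M = M := Real.mul_self_sqrt (by positivity)
  have hsMM : √(M : ℝ) ≤ M := by nlinarith
  -- Both outer factors are unit vectors; the middle entry carries the whole scale.
  let T : Triple M N 1 := ⟨fun _ _ => (√(M : ℝ))⁻¹, fun _ _ => √M * r, fun _ j => v j⟩
  have hTU (i j) : T.U i j = (√(M : ℝ))⁻¹ := rfl
  have hTS (i j) : T.S i j = √M * r := rfl
  have hTV (i j) : T.V i j = v j := rfl
  refine ⟨T, ⟨fun _ _ => by positivity, fun _ _ => by positivity, fun _ j => hv0 j⟩, ?_⟩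
  have hprod : ∀ i j, (T.U * T.S * T.V) i j = w j := by
    intro i j
    simp only [Matrix.mul_apply, Finset.univ_unique, Finset.sum_singleton, hTU, hTS, hTV, ← hrv j]
    rw [← mul_assoc, inv_mul_cancel₀ (by positivity), one_mul]
  have hfrob : frobSq (Y - T.U * T.S * T.V) ≤ M * N * η ^ 2 := by
    calc frobSq (Y - T.U * T.S * T.V) = ∑ i, ∑ j, |Y i j - w j| ^ 2 := by
          simp only [frobSq, Matrix.sub_apply, hprod]
      _ ≤ ∑ _i : Fin M, ∑ _j : Fin N, η ^ 2 := by
          gcongr with i _ j _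
          exact hY i j
      _ = M * N * η ^ 2 := by simp; ring
  have hUU : T.U.transpose * T.U - 1 = 0 := by
    ext i j
    have hij : i = j := Subsingleton.elim _ _
    subst hij
    simp only [Matrix.sub_apply, Matrix.mul_apply, Matrix.transpose_apply, hTU, Matrix.one_apply_eq,
      Finset.sum_const, Finset.card_univ, Fintype.card_fin, nsmul_eq_mul, Matrix.zero_apply]
    rw [← mul_inv, hsM2, mul_inv_cancel₀ (by positivity), sub_self]
  have hVV : T.V * T.V.transpose - 1 = 0 := by
    ext i j
    have hij : i = j := Subsingleton.elim _ _
    subst hij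
    simp only [Matrix.sub_apply, Matrix.mul_apply, Matrix.transpose_apply, hTV, Matrix.one_apply_eq,
      Matrix.zero_apply, hvs, sub_self]
  have hzero : l1Norm (0 : Matrix (Fin 1) (Fin 1) ℝ) = 0 := by simp [l1Norm]
  have hS : l1Norm T.S ≤ M * N := by
    have : l1Norm T.S = √M * r := by
      simp [l1Norm, hTS, abs_of_nonneg hr0]
    rw [this]
    gcongr
  have hU : l1Norm T.U ≤ M * N := by
    have : l1Norm T.U = M * (√(M : ℝ))⁻¹ := by
      simp [l1Norm, hTU]
    rw [this]
    gcongr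
    exact (inv_le_one_of_one_le₀ hsM).trans hN'
  have hV : l1Norm T.V ≤ M * N := by
    calc l1Norm T.V = ∑ j, v j := by simp [l1Norm, hTV, abs_of_nonneg (hv0 _)]
      _ ≤ ∑ _j : Fin N, (1 : ℝ) := Finset.sum_le_sum fun j _ => hv1 j
      _ = N := by simp
      _ ≤ M * N := by nlinarith
  simp only [J, hUU, hVV, hzero]
  have e1 := mul_le_mul_of_nonneg_left hS hγ
  have e2 := mul_le_mul_of_nonneg_left hU hν
  have e3 := mul_le_mul_of_nonneg_left hV hν
  linarith

/-! ### Probability that the rows nearly coincide -/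

/-- A cube of side `η` inside the unit cube is hit by each vector with probability at least
`C₁ η ^ d`. By independence, `n` such events happen together with probability at least
`(C₁ η ^ d) ^ n`. -/
theorem IsIIDWithDensityBounds.pow_le_real_box {Ω : Type*} [MeasurableSpace Ω] {P : Measure Ω}
    [IsProbabilityMeasure P] {n d : ℕ} {X : Fin n → Ω → (Fin d → ℝ)} {C₁ C₂ : ℝ}
    (hC₁ : 0 < C₁) (h : IsIIDWithDensityBounds P X C₁ C₂) {η : ℝ} (hη : 0 ≤ η)
    {a : Fin n → Fin d → ℝ} (ha : ∀ i j, 0 ≤ a i j) (ha1 : ∀ i j, a i j + η ≤ 1) :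
    (C₁ * η ^ d) ^ n ≤ P.real {ω | ∀ i j, X i ω j ∈ Set.Ico (a i j) (a i j + η)} := by
  obtain ⟨hX, hind, f, hf, hfb, hmap⟩ := h
  let B (i : Fin n) : Set (Fin d → ℝ) := Set.univ.pi fun j => Set.Ico (a i j) (a i j + η)
  have hB (i) : MeasurableSet (B i) := MeasurableSet.univ_pi fun _ => measurableSet_Ico
  have hset : {ω | ∀ i j, X i ω j ∈ Set.Ico (a i j) (a i j + η)}
      = ⋂ i ∈ (Finset.univ : Finset (Fin n)), X i ⁻¹' B i := by
    ext ω
    simp only [B, Set.mem_ofPred_eq, Set.mem_iInter, Set.mem_preimage, Set.mem_univ_pi,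
      Finset.mem_univ, forall_true_left]
  have hBcube (i) : B i ⊆ Set.Icc 0 1 := fun x hx => by
    simp only [B, Set.mem_univ_pi] at hx
    exact ⟨fun j => (ha i j).trans (hx j).1, fun j => (hx j).2.le.trans (ha1 i j)⟩
  have hone (i) : ENNReal.ofReal (C₁ * η ^ d) ≤ P (X i ⁻¹' B i) := by
    rw [← Measure.map_apply (hX i) (hB i), hmap i, withDensity_apply _ (hB i),
      Measure.restrict_restrict (hB i), Set.inter_eq_left.2 (hBcube i)]
    calc ENNReal.ofReal (C₁ * η ^ d) = ∫⁻ _ in B i, ENNReal.ofReal C₁ := by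
          rw [setLIntegral_const, ENNReal.ofReal_mul hC₁.le]
          simp only [B, Real.volume_pi_Ico]
          simp [ENNReal.ofReal_pow hη]
      _ ≤ ∫⁻ x in B i, ENNReal.ofReal (f x) :=
          setLIntegral_mono' (hB i) fun x hx => ENNReal.ofReal_le_ofReal (hfb x (hBcube i hx)).1.le
  rw [hset, Measure.real, hind.measure_inter_preimage_eq_mul Finset.univ fun i _ => hB i,
    ENNReal.toReal_prod]
  calc (C₁ * η ^ d) ^ n = ∏ _i : Fin n, C₁ * η ^ d := by simp
    _ ≤ ∏ i, (P (X i ⁻¹' B i)).toReal := by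
      refine Finset.prod_le_prod (fun _ _ => by positivity) fun i _ => ?_
      exact (ENNReal.ofReal_le_iff_le_toReal (measure_ne_top _ _)).1 (hone i)

/-- Since `c ^ d ≤ c ≤ C₁`, the box bound takes a form symmetric in `n` and `d`, common to the row
and column cases. -/
theorem mul_pow_mul_le_mul_pow_pow {c C₁ η : ℝ} (hc : 0 ≤ c) (hc1 : c ≤ 1) (hcC : c ≤ C₁)
    (hη : 0 ≤ η) {d : ℕ} (hd : 1 ≤ d) (n : ℕ) : (c * η) ^ (n * d) ≤ (C₁ * η ^ d) ^ n := by
  rw [mul_comm n d, pow_mul, mul_pow]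
  gcongr
  exact (pow_le_of_le_one hc hc1 (by omega)).trans hcC

/-- If `Y` has i.i.d. rows or i.i.d. columns, then the probability that its rows nearly coincide,
in the sense that all entries of each column lie in one cell of length `η` of the unit interval, is
bounded below. -/
theorem exists_event_rows_close {Ω : Type*} [MeasurableSpace Ω] {P : Measure Ω}
    [IsProbabilityMeasure P] {M N : ℕ} (hM : 1 ≤ M) (hN : 1 ≤ N) {Y : Ω → Matrix (Fin M) (Fin N) ℝ}
    {C₁ C₂ : ℝ} (hC₁ : 0 < C₁)
    (hY : IsIIDWithDensityBounds P (fun (i : Fin M) ω j => Y ω i j) C₁ C₂ ∨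
      IsIIDWithDensityBounds P (fun (j : Fin N) ω i => Y ω i j) C₁ C₂)
    {c η : ℝ} (hc : 0 ≤ c) (hc1 : c ≤ 1) (hcC : c ≤ C₁) (hη : 0 < η) (hη1 : η ≤ 1) :
    ∃ A : Set Ω, MeasurableSet A ∧
      (∀ ω ∈ A, ∃ w : Fin N → ℝ, (∀ j, 0 ≤ w j ∧ w j ≤ 1) ∧ ∀ i j, |Y ω i j - w j| ≤ η) ∧
      (2 * η)⁻¹ ^ N * (c * η) ^ (M * N) ≤ P.real A := by
  have hmeas (i j) : Measurable fun ω => Y ω i j := by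
    rcases hY with h | h
    · exact (measurable_pi_apply j).comp (h.1 i)
    · exact (measurable_pi_apply i).comp (h.1 j)
  have hbox (a : Fin M → Fin N → ℝ) (ha : ∀ i j, 0 ≤ a i j) (ha1 : ∀ i j, a i j + η ≤ 1) :
      (c * η) ^ (M * N) ≤ P.real {ω | ∀ i j, Y ω i j ∈ Set.Ico (a i j) (a i j + η)} := by
    rcases hY with h | h
    · exact (mul_pow_mul_le_mul_pow_pow hc hc1 hcC hη.le hN M).trans
        (h.pow_le_real_box hC₁ hη.le ha ha1)
    · refine (mul_comm M N ▸ mul_pow_mul_le_mul_pow_pow hc hc1 hcC hη.le hM N).trans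
        ((h.pow_le_real_box hC₁ hη.le (a := fun j i => a i j) (fun j i => ha i j)
          fun j i => ha1 i j).trans_eq ?_)
      congr 1
      ext ω
      exact forall_comm
  set G : ℕ := ⌊η⁻¹⌋₊ with hG
  have hG1 : 1 ≤ G := Nat.le_floor (by simpa using (one_le_inv₀ hη).2 hη1)
  have hGη : (G : ℝ) * η ≤ 1 := by
    rw [← le_div_iff₀ hη, one_div]
    exact Nat.floor_le (by positivity)
  have hG2 : (2 * η)⁻¹ ≤ G := by
    have h1 : η⁻¹ < G + 1 := Nat.lt_floor_add_one _
    have h2 : (1 : ℝ) ≤ G := by exact_mod_cast hG1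
    rw [mul_inv]
    linarith
  have hcell (k : Fin G) : (k : ℝ) * η + η ≤ 1 := by
    refine le_trans ?_ hGη
    have : (k : ℝ) + 1 ≤ G := by exact_mod_cast k.2
    nlinarith
  let E (k : Fin N → Fin G) : Set Ω :=
    {ω | ∀ i j, Y ω i j ∈ Set.Ico ((k j : ℝ) * η) ((k j : ℝ) * η + η)}
  have hE (k) : MeasurableSet (E k) := by
    have : E k = ⋂ i, ⋂ j, (fun ω => Y ω i j) ⁻¹'
        Set.Ico ((k j : ℝ) * η) ((k j : ℝ) * η + η) := by
      ext ω; simp [E]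
    rw [this]
    exact MeasurableSet.iInter fun i => MeasurableSet.iInter fun j =>
      hmeas i j measurableSet_Ico
  have hdisj : Pairwise fun k l => Disjoint (E k) (E l) := by
    intro k l hkl
    -- The first row already determines the cell of each column.
    refine Set.disjoint_left.2 fun ω hk hl => hkl (funext fun j => Fin.ext ?_)
    have h1 := hk ⟨0, hM⟩ j
    have h2 := hl ⟨0, hM⟩ j
    have hlt {a b : ℕ} {y : ℝ} (ha : (a : ℝ) * η ≤ y) (hb : y < (b : ℝ) * η + η) : a ≤ b := by
      have : (a : ℝ) < b + 1 := by
        refine lt_of_mul_lt_mul_right (?_ : (a : ℝ) * η < (b + 1) * η) hη.le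
        linarith
      exact Nat.lt_succ_iff.1 (by exact_mod_cast this)
    exact le_antisymm (hlt h1.1 h2.2) (hlt h2.1 h1.2)
  refine ⟨⋃ k, E k, MeasurableSet.iUnion hE, fun ω hω => ?_, ?_⟩
  · obtain ⟨k, hk⟩ := Set.mem_iUnion.1 hω
    refine ⟨fun j => (k j : ℝ) * η, fun j => ⟨by positivity, ?_⟩, fun i j => ?_⟩
    · linarith [hcell (k j)]
    · have := hk i j
      rw [abs_of_nonneg (by linarith [this.1])]
      linarith [this.2]
  · have hsum : P.real (⋃ k, E k) = ∑ k, P.real (E k) := by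
      simp only [Measure.real]
      rw [measure_iUnion hdisj hE, tsum_fintype,
        ENNReal.toReal_sum fun _ _ => measure_ne_top _ _]
    rw [hsum]
    calc (2 * η)⁻¹ ^ N * (c * η) ^ (M * N) ≤ (G : ℝ) ^ N * (c * η) ^ (M * N) := by gcongr
      _ = ∑ _k : Fin N → Fin G, (c * η) ^ (M * N) := by simp
      _ ≤ ∑ k, P.real (E k) := Finset.sum_le_sum fun k _ =>
          hbox (fun _ j => (k j : ℝ) * η) (fun _ j => by positivity) fun _ j => hcell (k j)

/-! ### Comparison of the two bounds -/

/-- The probability bound of the theorem, compared with the probability that the vectors in the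
shorter direction nearly coincide. -/
theorem target_le_event_bound {m n : ℕ} (hm : 2 ≤ m) (hmn : m ≤ n) {c ε δ : ℝ} (hc : 0 < c)
    (hc1 : c ≤ 1) (hε : 0 < ε) (hδ : δ ≤ Real.exp (-1)) (hεδ : ε * (m * n) ≤ δ) :
    (m : ℝ) * √(n / |Real.log ((c / 2) ^ 4 * ε)|) ^ n *
      ((c / 2) ^ 4 * ε) ^ (√(n / |Real.log ((c / 2) ^ 4 * ε)|) *
        (√(n / |Real.log ((c / 2) ^ 4 * ε)|) - 1) / 2 + (m : ℝ) * n - ((n : ℝ) - m) - 1) ≤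
    (2 * √ε)⁻¹ ^ n * (c * √ε) ^ (m * n) := by
  have hm' : (2 : ℝ) ≤ m := by exact_mod_cast hm
  have hmn' : (m : ℝ) ≤ n := by exact_mod_cast hmn
  have hn0 : (0 : ℝ) < n := by linarith
  have hx : 0 < (c / 2) ^ 4 * ε := by positivity
  set a : ℝ := -Real.log ((c / 2) ^ 4 * ε) with ha
  have hxa : (c / 2) ^ 4 * ε = Real.exp (-a) := by rw [ha, neg_neg, Real.exp_log hx]
  -- This is where `δ ≤ exp (-1)` enters.
  have hlog : Real.log m + Real.log n + 1 ≤ a := by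
    have h1 : (c / 2) ^ 4 * ε * (m * n) ≤ Real.exp (-1) :=
      calc (c / 2) ^ 4 * ε * (m * n) ≤ 1 * ε * (m * n) := by
            gcongr
            exact pow_le_one₀ (by positivity) (by linarith)
        _ ≤ Real.exp (-1) := by linarith
    have h2 := Real.log_le_log (by positivity) h1
    rw [Real.log_exp, Real.log_mul hx.ne' (by positivity),
      Real.log_mul (x := (m : ℝ)) (by positivity) (by positivity)] at h2
    linarith
  have hlm : 0 ≤ Real.log m := Real.log_nonneg (by linarith)
  have hln : 0 ≤ Real.log n := Real.log_nonneg (by linarith)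
  have ha1 : 1 ≤ a := by linarith
  have habs : |Real.log ((c / 2) ^ 4 * ε)| = a := by
    rw [abs_of_nonpos (by linarith)]
  rw [habs, hxa]
  set l : ℝ := √(n / a) with hl
  have hl0 : 0 ≤ l := Real.sqrt_nonneg _
  have hal : a * (l * l) = n := by
    rw [hl, Real.mul_self_sqrt (by positivity)]
    field_simp
  have hln2 : l ^ n ≤ Real.exp (n * (Real.log n / 2)) := by
    rw [Real.exp_nat_mul]
    gcongr
    rw [hl, Real.sqrt_le_left (Real.exp_pos _).le, ← Real.exp_nat_mul]
    push_cast
    rw [mul_div_cancel₀ _ (two_ne_zero), Real.exp_log (by linarith)]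
    exact div_le_self (by linarith) ha1
  obtain ⟨k, rfl⟩ : ∃ k, m = k + 1 := ⟨m - 1, by omega⟩
  have hk : 1 ≤ k := by omega
  have hk' : (1 : ℝ) ≤ k := by exact_mod_cast hk
  -- both sides are compared with `exp (-(a / 2) k n)`
  have hhalf : (c / 2) ^ 2 * √ε = Real.exp (-a / 2) := by
    have hs : ((c / 2) ^ 2 * √ε) ^ 2 = Real.exp (-a / 2) ^ 2 := by
      rw [mul_pow, Real.sq_sqrt hε.le, ← pow_mul, hxa, ← Real.exp_nat_mul]
      congr 1
      push_cast
      ring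
    exact (sq_eq_sq₀ (by positivity) (Real.exp_pos _).le).1 hs
  -- The number of cells cancels `n` of the `(k + 1) n` factors `√ε`; the fourth power in `(c / 2) ^
  -- 4` pays for the remaining constants.
  have hright : Real.exp (-a / 2) ^ (k * n) ≤ (2 * √ε)⁻¹ ^ n * (c * √ε) ^ ((k + 1) * n) := by
    have hs : 0 < √ε := Real.sqrt_pos.2 hε
    have e1 : (2 * √ε)⁻¹ ^ n * (c * √ε) ^ ((k + 1) * n)
        = (c / 2) ^ n * (c ^ (k * n) * √ε ^ (k * n)) := by
      rw [add_mul, one_mul, pow_add, mul_pow c, mul_comm _ ((c * √ε) ^ n), ← mul_assoc, ← mul_pow]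
      congr 2
      field_simp
    rw [e1, ← hhalf, mul_pow, ← mul_assoc, sq, mul_pow]
    have hc2 : c / 2 ≤ 1 := by linarith
    have e2 : (c / 2) ^ (k * n) ≤ (c / 2) ^ n :=
      pow_le_pow_of_le_one (by positivity) hc2 (Nat.le_mul_of_pos_left n hk)
    have e3 : (c / 2) ^ (k * n) ≤ c ^ (k * n) := by
      gcongr
      linarith
    gcongr
  refine le_trans ?_ hright
  rw [← Real.exp_mul, ← Real.exp_nat_mul]
  push_cast at hm' hmn' hlm hlog ⊢
  calc ((k : ℝ) + 1) * l ^ n *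
        Real.exp (-a * (l * (l - 1) / 2 + (k + 1) * n - (n - (k + 1)) - 1))
      ≤ Real.exp (Real.log (k + 1)) * Real.exp (n * (Real.log n / 2)) *
        Real.exp (-a * (l * (l - 1) / 2 + (k + 1) * n - (n - (k + 1)) - 1)) := by
        rw [Real.exp_log (by positivity)]
        gcongr
    _ ≤ Real.exp (k * n * (-a / 2)) := by
        rw [← Real.exp_add, ← Real.exp_add]
        apply Real.exp_le_exp.2
        -- By `a l² = n`, the term `-a l (l - 1) / 2` equals `-n / 2 + a l / 2`, and `2 l ≤ 1 + l²`.
        have e1 : a * l ≤ (a + n) / 2 := by nlinarith [mul_nonneg (by linarith : 0 ≤ a) (sq_nonneg (l - 1))]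
        have e2 : a * (n / 2 + 1) ≤ a * (k * (n / 2 + 1)) := by
          gcongr
          nlinarith
        have e3 : (n : ℝ) / 2 * (Real.log (k + 1) + Real.log n) ≤ n / 2 * a := by
          gcongr
          linarith
        have e4 : Real.log (k + 1) ≤ n / 2 * Real.log (k + 1) := by nlinarith
        nlinarith

/-! ### Assembly -/

/-- If `M ≤ N`, then on an event of probability at least `lowerBound` the rows nearly coincide, so
that the functional is small at some non-negative triple of inner dimension one. -/
theorem exists_event_triple_one {Ω : Type*} [MeasurableSpace Ω] {P : Measure Ω}
    [IsProbabilityMeasure P] {M N : ℕ} (hM : 2 ≤ M) (hMN : M ≤ N)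
    {Y : Ω → Matrix (Fin M) (Fin N) ℝ} {C₁ C₂ : ℝ} (hC₁ : 0 < C₁)
    (hY : IsIIDWithDensityBounds P (fun (i : Fin M) ω j => Y ω i j) C₁ C₂ ∨
      IsIIDWithDensityBounds P (fun (j : Fin N) ω i => Y ω i j) C₁ C₂)
    {c K δ α ν γ ε : ℝ} (hc : 0 < c) (hc1 : c ≤ 1) (hcC : c ≤ C₁) (hν : 0 ≤ ν) (hγ : 0 ≤ γ)
    (hε : 0 < ε) (hε1 : ε ≤ 1) (hδ : δ ≤ Real.exp (-1)) (hεδ : ε * (M * N) ≤ δ)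
    (hK : γ + 2 * ν ≤ (K - 1) * ε) (hKδ : K * ε * (M * N) < δ) :
    ∃ A : Set Ω, MeasurableSet A ∧
      (∀ ω ∈ A, ∃ T : Triple M N 1, T.Nonneg ∧ J α ν γ (Y ω) T < δ) ∧
      lowerBound ((c / 2) ^ 4) ε N M ≤ P.real A := by
  obtain ⟨A, hA, hAw, hAP⟩ := exists_event_rows_close (by omega) (by omega) hC₁ hY hc.le hc1 hcC
    (Real.sqrt_pos.2 hε) (Real.sqrt_le_one.2 hε1)
  have hMN' : (M : ℝ) ≤ N := by exact_mod_cast hMN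
  refine ⟨A, hA, fun ω hω => ?_, ?_⟩
  · obtain ⟨w, hw, hYw⟩ := hAw ω hω
    obtain ⟨T, hT, hJ⟩ := exists_triple_one_of_rows (α := α) (by omega) (by omega) hν hγ hw hYw
    refine ⟨T, hT, hJ.trans_lt ?_⟩
    rw [Real.sq_sqrt hε.le]
    have := mul_le_mul_of_nonneg_right hK (by positivity : (0 : ℝ) ≤ M * N)
    linarith
  · refine le_trans (le_of_eq ?_) ((target_le_event_bound hM hMN hc hc1 hε hδ hεδ).trans hAP)
    simp only [lowerBound, pOpt, mu, min_eq_right hMN', max_eq_right hMN', max_eq_left hMN,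
      abs_of_nonneg (sub_nonneg.2 hMN')]

theorem lowerBound_comm (C₃ ε : ℝ) (N M : ℕ) : lowerBound C₃ ε N M = lowerBound C₃ ε M N := by
  simp only [lowerBound, pOpt, mu, min_comm (N : ℝ), max_comm (M : ℝ), max_comm N M,
    abs_sub_comm (N : ℝ), mul_comm (M : ℝ) N]

theorem Triple.Nonneg.transpose {M N p : ℕ} {T : Triple M N p} (hT : T.Nonneg) :
    (⟨T.V.transpose, T.S.transpose, T.U.transpose⟩ : Triple N M p).Nonneg :=
  ⟨fun i j => hT.2.2 j i, fun i j => hT.2.1 j i, fun i j => hT.1 j i⟩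

end TriNMF

theorem mainTheorem3 (C₁ C₂ : ℝ) (hC₁ : 0 < C₁) (hC : C₁ < C₂) :
    ∃ C₃ δ₀ : ℝ, 0 < C₃ ∧ 0 < δ₀ ∧
      ∀ (M N : ℕ), 2 ≤ M → 2 ≤ N →
      ∀ (Ω : Type*) [MeasurableSpace Ω] (P : Measure Ω) [IsProbabilityMeasure P]
        (Y : Ω → Matrix (Fin M) (Fin N) ℝ),
        (TriNMF.IsIIDWithDensityBounds P (fun (i : Fin M) ω j => Y ω i j) C₁ C₂ ∨
          TriNMF.IsIIDWithDensityBounds P (fun (j : Fin N) ω i => Y ω i j) C₁ C₂) →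
      ∀ (K C L δ α ν γ ε : ℝ), 1 < K → 0 < C → 0 < L → 0 < δ → δ < δ₀ →
        0 ≤ α → 0 < ν → 0 < γ →
        ε = TriNMF.eps K C L N M δ →
        γ + 2 * ν ≤ (K - 1) * ε →
        (∀ ω, ∀ p : ℕ, 1 ≤ p → ∃ T : TriNMF.Triple M N p, TriNMF.IsMinimizer α ν γ (Y ω) T) ∧
        C₃ * ε < 1 ∧
        ∀ q : ℕ → ℕ,
          (∀ p ∈ Set.Icc 1 (min M N),
            Real.exp (-L * ε) * (p : ℝ) ^ 2 < (q p : ℝ) ∧ q p ≤ p ^ 2) →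
          ∃ A : Set Ω, MeasurableSet A ∧
            (∀ ω ∈ A, TriNMF.TruncatedMinLT α ν γ δ q (Y ω)) ∧
            TriNMF.lowerBound C₃ ε N M ≤ P.real A := by
  have hc : 0 < min C₁ 1 := lt_min hC₁ one_pos
  have hc1 : min C₁ 1 ≤ 1 := min_le_right _ _
  have hcC : min C₁ 1 ≤ C₁ := min_le_left _ _
  refine ⟨(min C₁ 1 / 2) ^ 4, Real.exp (-1), by positivity, Real.exp_pos _, ?_⟩
  intro M N hM hN Ω _ P _ Y hY K C L δ α ν γ ε hK hCpos hL hδ hδ₀ hα hν hγ hε hreg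
  have hM' : (2 : ℝ) ≤ M := by exact_mod_cast hM
  have hN' : (2 : ℝ) ≤ N := by exact_mod_cast hN
  have hD : K * (M * N) < (K + C * L) * N * M + (min (M : ℝ) N) ^ 2 := by
    have h1 : 0 < C * L * (M * N) := by positivity
    have h2 : 0 ≤ (min (M : ℝ) N) ^ 2 := sq_nonneg _
    linarith
  have hMN0 : (0 : ℝ) < M * N := by positivity
  have hD0 : 0 < (K + C * L) * N * M + (min (M : ℝ) N) ^ 2 := lt_trans (by positivity) hD
  have hε0 : 0 < ε := by
    rw [hε, TriNMF.eps]
    positivity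
  have hKδ : K * ε * (M * N) < δ := by
    have : δ = ε * ((K + C * L) * N * M + (min (M : ℝ) N) ^ 2) := by
      rw [hε, TriNMF.eps, inv_mul_cancel_right₀ hD0.ne']
    rw [this]
    linarith [mul_lt_mul_of_pos_left hD hε0]
  have hεδ : ε * (M * N) ≤ δ := by
    have : 1 * (ε * (M * N)) ≤ K * (ε * (M * N)) := by gcongr
    linarith
  have hδ1 : δ < 1 := hδ₀.trans (Real.exp_zero ▸ Real.exp_lt_exp.2 (by norm_num))
  have hε1 : ε < 1 := by
    have : ε * 1 ≤ ε * (M * N) := by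
      gcongr
      nlinarith
    linarith
  refine ⟨fun ω p _ => TriNMF.exists_isMinimizer hα hν hγ (Y ω), ?_, fun q hq => ?_⟩
  · calc (min C₁ 1 / 2) ^ 4 * ε ≤ 1 * ε := by
          gcongr
          exact pow_le_one₀ (by positivity) (by linarith)
      _ < 1 := by linarith
  -- The lower bound on `q 1` is positive, so the integer `q 1 ≤ 1` must be `1`.
  have hq1 : q 1 = 1 := by
    obtain ⟨h1, h2⟩ := hq 1 ⟨le_rfl, le_min (by omega) (by omega)⟩
    have h3 : (0 : ℝ) < q 1 := lt_trans (by positivity) h1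
    have h4 : 0 < q 1 := by exact_mod_cast h3
    omega
  suffices h : ∃ A : Set Ω, MeasurableSet A ∧
      (∀ ω ∈ A, ∃ T : TriNMF.Triple M N 1, T.Nonneg ∧ TriNMF.J α ν γ (Y ω) T < δ) ∧
      TriNMF.lowerBound ((min C₁ 1 / 2) ^ 4) ε N M ≤ P.real A by
    obtain ⟨A, hA, hAT, hAP⟩ := h
    refine ⟨A, hA, fun ω hω => ?_, hAP⟩
    obtain ⟨T, hT, hJ⟩ := hAT ω hω
    exact TriNMF.truncatedMinLT_of_triple_one (by omega) (by omega) hq1 hT hJ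
  rcases le_total M N with hMN | hNM
  · exact TriNMF.exists_event_triple_one hM hMN hC₁ hY hc hc1 hcC hν.le hγ.le hε0 hε1.le hδ₀.le
      hεδ hreg hKδ
  -- Transposing `Y` swaps the row and column hypotheses, hence `hY.symm`.
  · obtain ⟨A, hA, hAT, hAP⟩ := TriNMF.exists_event_triple_one (α := α) (K := K) hN hNM
      (Y := fun ω => (Y ω).transpose) hC₁ hY.symm hc hc1 hcC hν.le hγ.le hε0 hε1.le hδ₀.le
      (by rwa [mul_comm (N : ℝ)]) hreg (by rwa [mul_comm (N : ℝ)])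
    refine ⟨A, hA, fun ω hω => ?_, by rwa [TriNMF.lowerBound_comm]⟩
    obtain ⟨T, hT, hJ⟩ := hAT ω hω
    refine ⟨_, hT.transpose, ?_⟩
    rwa [← TriNMF.J_transpose, Matrix.transpose_transpose, Matrix.transpose_transpose,
      Matrix.transpose_transpose]
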